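/- For positive integers $j,k,n$ let $d_{j,k}(n)$ denote the number of positive divisors $d$ of $n$ with $d\equiv j \pmod k$. Let $q\in\mathbb{C}$ with $|q|<1$. Then the infinite products and series below converge, and $$ q\prod_{n=1}^{\infty}\frac{(1-q^n)^2}{(1-q^{5n-2})^5(1-q^{5n-3})^5} =\sum_{n=1}^{\infty}\bigl(d_{1,5}(n)-d_{4,5}(n)\bigr)q^n-3\sum_{n=1}^{\infty}\bigl(d_{2,5}(n)-d_{3,5}(n)\bigr)q^n $$ and $$ \prod_{n=1}^{\infty}\frac{(1-q^n)^2}{(1-q^{5n-1})^5(1-q^{5n-4})^5} =1+3\sum_{n=1}^{\infty}\bigl(d_{1,5}(n)-d_{4,5}(n)\bigr)q^n+\sum_{n=1}^{\infty}\bigl(d_{2,5}(n)-d_{3,5}(n)\bigr)q^n . $$ -/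

import Mathlib

/-- The number of positive divisors `d` of `n` such that `d ≡ j (mod k)`
(for the positive integers `n`; the value at `n = 0` is `0` and is not used). -/
def divisorCount (j k n : ℕ) : ℕ :=
  (n.divisors.filter (fun d => d ≡ j [MOD k])).card

/-! Write θ(z) = (z;p)_∞ (p/z;p)_∞ and L(z) = zθ'(z)/θ(z). Both identities are specialisations, at p
= q⁵, of `thetaProd_triplication`, which expresses θ(a²)³ (p;p)_∞² through θ(a), θ(a³), L(a) and
L(a³).

Splitting the Laurent expansion by parity makes θ(xy)θ(x/y)/x a 2×2 determinant in x and y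
(`thetaPair_eq`). Weierstrass's three-term relation is then the Plücker relation, and its derivative
at a point where one term vanishes is the triplication formula. The constant Laurent coefficient is
never evaluated, so the full Jacobi triple product is not needed.

For a = q and a = q², quasi-periodicity and the symmetry z ↦ p/z reduce everything to θ(q), θ(q²),
L(q), L(q²). The theta values are products over residue classes mod 5, and the L values are Lambert
series generating the divisor differences (`hasSum_divisorCount_sub`). -/

open Filter Topology

/-- The infinite `q`-Pochhammer symbol `(z; p)_∞ = ∏_{n ≥ 0} (1 - z p^n)`. -/
noncomputable def qPochInf (p z : ℂ) : ℂ := ∏' n : ℕ, (1 - z * p ^ n)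

/-! ### Infinite products: analyticity, logarithmic derivative, Euler's expansion. -/

section qPochInf

variable {p : ℂ}

lemma summable_norm_mul_pow (hp : ‖p‖ < 1) (z : ℂ) : Summable fun n : ℕ => ‖-(z * p ^ n)‖ := by
  simpa [norm_mul, norm_pow] using
    (summable_geometric_of_lt_one (norm_nonneg p) hp).mul_left ‖z‖

lemma multipliable_one_sub_mul_pow (hp : ‖p‖ < 1) (z : ℂ) :
    Multipliable fun n : ℕ => 1 - z * p ^ n := by
  simpa [sub_eq_add_neg] using multipliable_one_add_of_summable (summable_norm_mul_pow hp z)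

lemma hasProd_qPochInf (hp : ‖p‖ < 1) (z : ℂ) :
    HasProd (fun n : ℕ => 1 - z * p ^ n) (qPochInf p z) :=
  (multipliable_one_sub_mul_pow hp z).hasProd

lemma qPochInf_ne_zero (hp : ‖p‖ < 1) {z : ℂ} (hz : ∀ n : ℕ, z * p ^ n ≠ 1) :
    qPochInf p z ≠ 0 := by
  have := tprod_one_add_ne_zero_of_summable (f := fun n : ℕ => -(z * p ^ n))
    (fun n h => hz n (by linear_combination -h)) (summable_norm_mul_pow hp z)
  simpa [qPochInf, sub_eq_add_neg] using this

lemma qPochInf_eq_one_sub_mul (hp : ‖p‖ < 1) (z : ℂ) :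
    qPochInf p z = (1 - z) * qPochInf p (z * p) := by
  have e : ∀ n : ℕ, 1 - z * p ^ (n + 1) = 1 - z * p * p ^ n := fun n => by ring
  have h : Multipliable fun n : ℕ => 1 - z * p ^ (n + 1) := by
    simpa only [e] using multipliable_one_sub_mul_pow hp (z * p)
  calc qPochInf p z = (1 - z * p ^ 0) * ∏' n : ℕ, (1 - z * p ^ (n + 1)) :=
        tprod_eq_zero_mul' (f := fun n : ℕ => 1 - z * p ^ n) h
    _ = (1 - z) * qPochInf p (z * p) := by simp only [e, pow_zero, mul_one, qPochInf]

/-- A geometric majorant for `z * p ^ n` exists only on bounded sets; letting `R` vary still covers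
the whole plane. -/
lemma multipliableLocallyUniformlyOn_one_sub_mul_pow (hp : ‖p‖ < 1) (R : ℝ) :
    MultipliableLocallyUniformlyOn (fun (n : ℕ) (z : ℂ) => 1 - z * p ^ n) (Metric.ball 0 R) := by
  have := Summable.multipliableLocallyUniformlyOn_nat_one_add
    (f := fun (n : ℕ) (z : ℂ) => -(z * p ^ n)) (K := Metric.ball (0 : ℂ) R) Metric.isOpen_ball
    ((summable_geometric_of_lt_one (norm_nonneg p) hp).mul_left R)
    (Eventually.of_forall fun n z hz => by
      have : ‖z‖ < R := by simpa using hz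
      rw [norm_neg, norm_mul, norm_pow]
      gcongr)
    (fun n => by fun_prop)
  simpa [sub_eq_add_neg] using this

lemma differentiable_qPochInf (hp : ‖p‖ < 1) : Differentiable ℂ (qPochInf p) := by
  intro z
  have h := (multipliableLocallyUniformlyOn_one_sub_mul_pow hp
    (‖z‖ + 1)).hasProdLocallyUniformlyOn.differentiableOn
    (.of_forall fun s => by
      simpa [Finset.prod_fn] using DifferentiableOn.finsetProd (fun _ _ ↦ by fun_prop))
    Metric.isOpen_ball
  exact h.differentiableAt (Metric.isOpen_ball.mem_nhds (by simp))

lemma logDeriv_one_sub_mul (c z : ℂ) :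
    logDeriv (fun z : ℂ => 1 - z * c) z = -(c / (1 - z * c)) := by
  have : HasDerivAt (fun z : ℂ => 1 - z * c) (-c) z := by
    simpa using ((hasDerivAt_id z).mul_const c).const_sub 1
  rw [logDeriv_apply, this.deriv, neg_div]

lemma summable_pow_div_one_sub_mul_pow (hp : ‖p‖ < 1) (z : ℂ) :
    Summable fun n : ℕ => p ^ n / (1 - z * p ^ n) := by
  simp only [div_eq_mul_inv]
  apply Summable.mul_tendsto_const (c := (1 - z * 0)⁻¹)
  · simpa using summable_geometric_of_lt_one (norm_nonneg p) hp
  · rw [Nat.cofinite_eq_atTop]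
    exact (((tendsto_pow_atTop_nhds_zero_of_norm_lt_one hp).const_mul z).const_sub 1).inv₀
      (by simp)

lemma logDeriv_qPochInf (hp : ‖p‖ < 1) {z : ℂ} (hz : ∀ n : ℕ, z * p ^ n ≠ 1) :
    logDeriv (qPochInf p) z = -∑' n : ℕ, p ^ n / (1 - z * p ^ n) := by
  have h := logDeriv_tprod_eq_tsum (f := fun (n : ℕ) (z : ℂ) => 1 - z * p ^ n)
    (Metric.isOpen_ball (x := (0 : ℂ)) (ε := ‖z‖ + 1)) (x := z) (by simp)
    (fun n => sub_ne_zero.2 (hz n).symm) (fun n => by fun_prop)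
    (by
      simp only [logDeriv_one_sub_mul]
      exact (summable_pow_div_one_sub_mul_pow hp z).neg)
    (multipliableLocallyUniformlyOn_one_sub_mul_pow hp _) (qPochInf_ne_zero hp hz)
  simp only [logDeriv_one_sub_mul, tsum_neg] at h
  exact h

/-- The coefficients of Euler's expansion of `(z; p)_∞` in powers of `z`. -/
noncomputable def eulerCoeff (p : ℂ) : ℕ → ℂ
  | 0 => 1
  | n + 1 => -(p ^ n / (1 - p ^ (n + 1))) * eulerCoeff p n

lemma one_sub_pow_succ_ne_zero (hp : ‖p‖ < 1) (n : ℕ) : 1 - p ^ (n + 1) ≠ 0 := by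
  intro h
  have h1 : ‖p ^ (n + 1)‖ < 1 := by
    rw [norm_pow]; exact pow_lt_one₀ (norm_nonneg _) hp (by simp)
  rw [← sub_eq_zero.1 h] at h1
  simp at h1

lemma eulerCoeff_succ_mul (hp : ‖p‖ < 1) (n : ℕ) :
    eulerCoeff p (n + 1) * (1 - p ^ (n + 1)) = -(p ^ n * eulerCoeff p n) := by
  have := one_sub_pow_succ_ne_zero hp n
  rw [eulerCoeff]
  field_simp

lemma summable_eulerCoeff_mul_pow (hp : ‖p‖ < 1) (z : ℂ) :
    Summable fun n : ℕ => ‖eulerCoeff p n * z ^ n‖ := by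
  have ht : Tendsto (fun n : ℕ => ‖p ^ n / (1 - p ^ (n + 1)) * z‖) atTop (𝓝 0) := by
    have h1 := tendsto_pow_atTop_nhds_zero_of_norm_lt_one hp
    have h2 := ((h1.comp (tendsto_add_atTop_nat 1)).const_sub 1)
    simpa using ((h1.div h2 (by simp)).mul_const z).norm
  -- The ratio of consecutive terms tends to 0 for every `z`, so any bound below 1 would serve.
  refine summable_of_ratio_norm_eventually_le (r := 1 / 2) (by norm_num) ?_
  filter_upwards [ht.eventually (ge_mem_nhds (show (0 : ℝ) < 1 / 2 by norm_num))] with n hn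
  rw [norm_norm, norm_norm]
  have : eulerCoeff p (n + 1) * z ^ (n + 1)
      = -((p ^ n / (1 - p ^ (n + 1)) * z) * (eulerCoeff p n * z ^ n)) := by
    rw [eulerCoeff]; ring
  rw [this, norm_neg, norm_mul]
  gcongr

lemma tsum_eulerCoeff_eq_one_sub_mul (hp : ‖p‖ < 1) (z : ℂ) :
    ∑' n, eulerCoeff p n * z ^ n = (1 - z) * ∑' n, eulerCoeff p n * (z * p) ^ n := by
  have h1 := (summable_eulerCoeff_mul_pow hp z).of_norm
  have h2 := (summable_eulerCoeff_mul_pow hp (z * p)).of_norm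
  have h3 : ∑' n, (eulerCoeff p n * z ^ n - eulerCoeff p n * (z * p) ^ n)
      = ∑' n, -z * (eulerCoeff p n * (z * p) ^ n) := by
    rw [(h1.sub h2).tsum_eq_zero_add]
    simp only [pow_zero, sub_self, zero_add]
    refine tsum_congr fun n => ?_
    have := eulerCoeff_succ_mul hp n
    simp only [mul_pow]
    linear_combination z ^ (n + 1) * this
  rw [h1.tsum_sub h2, tsum_mul_left] at h3
  linear_combination h3

/-- Euler's expansion of `(z; p)_∞`. -/
lemma qPochInf_eq_tsum (hp : ‖p‖ < 1) (z : ℂ) :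
    qPochInf p z = ∑' n, eulerCoeff p n * z ^ n := by
  -- The series obeys the same equation f(z) = (1 - z) f(zp) as the product; iterate it and let
  -- f(zp^N) tend to f(0) = 1.
  have key : ∀ N : ℕ, ∑' n, eulerCoeff p n * z ^ n =
      (∏ i ∈ Finset.range N, (1 - z * p ^ i)) * ∑' n, eulerCoeff p n * (z * p ^ N) ^ n := by
    intro N
    induction N with
    | zero => simp
    | succ N ih =>
      rw [ih, tsum_eulerCoeff_eq_one_sub_mul hp (z * p ^ N), Finset.prod_range_succ, pow_succ]
      ring_nf
  have h1 : Tendsto (fun N : ℕ => ∑' n, eulerCoeff p n * (z * p ^ N) ^ n) atTop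
      (𝓝 (∑' n, eulerCoeff p n * (0 : ℂ) ^ n)) := by
    refine tendsto_tsum_of_dominated_convergence (summable_eulerCoeff_mul_pow hp z) ?_ ?_
    · intro n
      have := ((tendsto_pow_atTop_nhds_zero_of_norm_lt_one hp).const_mul z)
      rw [mul_zero] at this
      exact (this.pow n).const_mul _
    · refine Eventually.of_forall fun N n => ?_
      rw [norm_mul, norm_mul, norm_pow, norm_pow, norm_mul, norm_pow]
      gcongr
      exact mul_le_of_le_one_right (norm_nonneg _) (pow_le_one₀ (norm_nonneg _) hp.le)
  have h2 : ∑' n, eulerCoeff p n * (0 : ℂ) ^ n = 1 := by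
    rw [tsum_eq_single 0 (fun n hn => by simp [hn])]
    simp [eulerCoeff]
  have h3 := (hasProd_qPochInf hp z).tendsto_prod_nat.mul h1
  rw [h2, mul_one] at h3
  refine tendsto_nhds_unique h3 ?_
  simp only [← key]
  exact tendsto_const_nhds

end qPochInf

/-! ### Laurent coefficients of the theta function. -/

section theta

variable {p : ℂ}

/-- The coefficients of Euler's expansion, extended by zero to negative indices. -/
noncomputable def eulerCoeffInt (p : ℂ) (k : ℤ) : ℂ := if 0 ≤ k then eulerCoeff p k.toNat else 0

lemma eulerCoeffInt_natCast (n : ℕ) : eulerCoeffInt p n = eulerCoeff p n := by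
  simp [eulerCoeffInt]

lemma eulerCoeffInt_of_neg {k : ℤ} (hk : k < 0) : eulerCoeffInt p k = 0 := by
  simp [eulerCoeffInt, hk.not_ge]

/-- Coefficient form of (z;p)_∞ = (1 - z)(zp;p)_∞; extension by zero makes it valid at every
integer. -/
lemma eulerCoeffInt_eq (hp : ‖p‖ < 1) (k : ℤ) :
    eulerCoeffInt p k = p ^ k * eulerCoeffInt p k - p ^ (k - 1) * eulerCoeffInt p (k - 1) := by
  rcases lt_trichotomy k 0 with hk | rfl | hk
  · simp [eulerCoeffInt_of_neg hk, eulerCoeffInt_of_neg (show k - 1 < 0 by lia)]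
  · simp [eulerCoeffInt_of_neg (show (-1 : ℤ) < 0 by lia)]
  · obtain ⟨n, rfl⟩ : ∃ n : ℕ, k = (n + 1 : ℕ) := ⟨(k - 1).toNat, by lia⟩
    rw [show ((n + 1 : ℕ) : ℤ) - 1 = (n : ℕ) by push_cast; ring, eulerCoeffInt_natCast,
      eulerCoeffInt_natCast, zpow_natCast, zpow_natCast]
    linear_combination eulerCoeff_succ_mul hp n

lemma eulerCoeffInt_eq_zero_of_notMem_range (z : ℂ) (k : ℤ) (hk : k ∉ Set.range ((↑) : ℕ → ℤ)) :
    eulerCoeffInt p k * z ^ k = 0 := by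
  rw [eulerCoeffInt_of_neg, zero_mul]
  by_contra! h
  exact hk ⟨k.toNat, by lia⟩

lemma hasSum_eulerCoeffInt (hp : ‖p‖ < 1) (z : ℂ) :
    HasSum (fun k : ℤ => eulerCoeffInt p k * z ^ k) (qPochInf p z) := by
  rw [← Function.Injective.hasSum_iff Nat.cast_injective
    (eulerCoeffInt_eq_zero_of_notMem_range z), qPochInf_eq_tsum hp]
  simpa [Function.comp_def, eulerCoeffInt_natCast] using
    (summable_eulerCoeff_mul_pow hp z).of_norm.hasSum

lemma summable_eulerCoeffInt_prod (hp : ‖p‖ < 1) (z w : ℂ) :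
    Summable fun x : ℤ × ℤ => (eulerCoeffInt p x.1 * z ^ x.1) * (eulerCoeffInt p x.2 * w ^ x.2) := by
  have h (z : ℂ) : Summable fun k : ℤ => ‖eulerCoeffInt p k * z ^ k‖ :=
    (hasSum_eulerCoeffInt hp z).summable.norm
  exact summable_mul_of_summable_norm (f := fun k : ℤ => eulerCoeffInt p k * z ^ k)
    (g := fun k : ℤ => eulerCoeffInt p k * w ^ k) (h z) (h w)

lemma summable_eulerCoeffInt_add (hp : ‖p‖ < 1) (k : ℤ) (c : ℂ) :
    Summable fun m : ℤ => eulerCoeffInt p (k + m) * eulerCoeffInt p m * c ^ m := by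
  have := (summable_eulerCoeffInt_prod hp 1 c).comp_injective
    (i := fun m : ℤ => (k + m, m)) (fun a b h => (Prod.ext_iff.1 h).2)
  simpa [Function.comp_def, mul_assoc] using this

/-- The Laurent coefficients of `(z; p)_∞ (p / z; p)_∞`. -/
noncomputable def thetaCoeff (p : ℂ) (k : ℤ) : ℂ :=
  ∑' m : ℤ, eulerCoeffInt p (k + m) * eulerCoeffInt p m * p ^ m

/-- The recurrence is applied once to each of the two Euler factors. With A and B the sums weighted
by p^(2m) at shifts k + 1 and k, this gives T_k = B - pA and T_(k+1) = p^(k+1) A - p^k B; eliminate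
A and B. -/
lemma thetaCoeff_add_one (hp : ‖p‖ < 1) (hp0 : p ≠ 0) (k : ℤ) :
    thetaCoeff p (k + 1) = -(p ^ k * thetaCoeff p k) := by
  have hA := (summable_eulerCoeffInt_add hp (k + 1) (p ^ 2)).hasSum
  set A := ∑' m : ℤ, eulerCoeffInt p (k + 1 + m) * eulerCoeffInt p m * (p ^ 2) ^ m
  have hT := (summable_eulerCoeffInt_add hp k p).hasSum
  have hB : HasSum (fun m : ℤ => eulerCoeffInt p (k + m) * eulerCoeffInt p m * (p ^ 2) ^ m)
      (thetaCoeff p k + p * A) := by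
    have hA' := ((Equiv.subRight (1 : ℤ)).hasSum_iff.2 hA).mul_left p
    refine (hT.add hA').congr_fun ?_
    intro m
    simp only [Function.comp_apply, Equiv.subRight_apply]
    rw [show k + 1 + (m - 1) = k + m by ring]
    have := eulerCoeffInt_eq hp m
    have e1 : (p ^ 2) ^ m = p ^ m * p ^ m := by rw [pow_two, mul_zpow]
    have e2 : (p ^ 2) ^ (m - 1) = p ^ (m - 1) * p ^ (m - 1) := by rw [pow_two, mul_zpow]
    have e3 : p ^ m = p * p ^ (m - 1) := by
      rw [← zpow_one_add₀ hp0]; congr 1; ring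
    rw [e1, e2]
    linear_combination (-(eulerCoeffInt p (k + m) * p ^ m)) * this +
      eulerCoeffInt p (k + m) * eulerCoeffInt p (m - 1) * p ^ (m - 1) * e3
  have hC := (hA.mul_left (p ^ (k + 1))).sub (hB.mul_left (p ^ k))
  have hT1 := (summable_eulerCoeffInt_add hp (k + 1) p).hasSum
  have := (hC.congr_fun (g := fun m : ℤ =>
      eulerCoeffInt p (k + 1 + m) * eulerCoeffInt p m * p ^ m) ?_).unique hT1
  · rw [thetaCoeff, ← this, zpow_add_one₀ hp0]
    ring
  · intro m
    have h1 := eulerCoeffInt_eq hp (k + 1 + m)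
    rw [show k + 1 + m - 1 = k + m by ring] at h1
    have e1 : (p ^ 2) ^ m = p ^ m * p ^ m := by rw [pow_two, mul_zpow]
    rw [e1]
    rw [zpow_add₀ hp0 (k + 1), zpow_add₀ hp0 k m] at h1
    linear_combination (eulerCoeffInt p m * p ^ m) * h1

/-- The triangular number `k (k - 1) / 2`. -/
def triangular (k : ℤ) : ℤ := k * (k - 1) / 2

lemma two_mul_triangular (k : ℤ) : 2 * triangular k = k * (k - 1) :=
  Int.two_mul_ediv_two_of_even (Int.even_mul_pred_self k)

lemma triangular_add_one (k : ℤ) : triangular (k + 1) = triangular k + k := by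
  have h1 := two_mul_triangular k
  have h2 := two_mul_triangular (k + 1)
  linarith

lemma thetaCoeff_eq (hp : ‖p‖ < 1) (hp0 : p ≠ 0) (k : ℤ) :
    thetaCoeff p k = thetaCoeff p 0 * (-1) ^ k * p ^ triangular k := by
  have step : ∀ k : ℤ, thetaCoeff p 0 * (-1) ^ (k + 1) * p ^ triangular (k + 1) =
      -(p ^ k * (thetaCoeff p 0 * (-1) ^ k * p ^ triangular k)) := by
    intro k
    rw [triangular_add_one, zpow_add₀ hp0, zpow_add_one₀ (by norm_num)]
    ring
  induction k using Int.induction_on with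
  | zero => simp [triangular]
  | succ k ih => rw [thetaCoeff_add_one hp hp0, ih, step]
  | pred k ih =>
    have h1 := thetaCoeff_add_one hp hp0 (-k - 1)
    have h2 := step (-k - 1)
    rw [sub_add_cancel, ih] at h1
    rw [sub_add_cancel] at h2
    have : p ^ (-(k : ℤ) - 1) ≠ 0 := zpow_ne_zero _ hp0
    refine mul_left_cancel₀ this ?_
    linear_combination h1 - h2

/-- The theta function `(z; p)_∞ (p / z; p)_∞`. -/
noncomputable def thetaProd (p z : ℂ) : ℂ := qPochInf p z * qPochInf p (p / z)

lemma hasSum_thetaCoeff (hp : ‖p‖ < 1) {z : ℂ} (hz : z ≠ 0) :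
    HasSum (fun k : ℤ => thetaCoeff p k * z ^ k) (thetaProd p z) := by
  have h := summable_eulerCoeffInt_prod hp z (p / z)
  have hs : HasSum _ (thetaProd p z) :=
    (hasSum_eulerCoeffInt hp z).mul (hasSum_eulerCoeffInt hp (p / z)) h
  -- Indexing by the difference of the two exponents collects equal powers of `z`.
  let e : ℤ × ℤ ≃ ℤ × ℤ :=
    { toFun := fun x => (x.1 + x.2, x.2)
      invFun := fun x => (x.1 - x.2, x.2)
      left_inv := fun x => by simp
      right_inv := fun x => by simp }
  rw [← e.hasSum_iff] at hs
  refine hs.prod_fiberwise fun k => ?_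
  refine ((summable_eulerCoeffInt_add hp k p).hasSum.mul_right (z ^ k)).congr_fun fun m => ?_
  simp only [Function.comp_apply, e, Equiv.coe_fn_mk, div_zpow, zpow_add₀ hz]
  have := zpow_ne_zero m hz
  field_simp

end theta

/-! ### Parity splitting and the three-term relation. -/

section threeTerm

variable {p : ℂ}

/-- The even part in the parity splitting of `θ(x y) θ(x / y)`. -/
noncomputable def thetaEven (p x : ℂ) : ℂ := thetaCoeff p 0 * ∑' i : ℤ, x ^ (2 * i) * p ^ (i * i)

/-- The odd part in the parity splitting of `θ(x y) θ(x / y)`. -/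
noncomputable def thetaOdd (p x : ℂ) : ℂ :=
  thetaCoeff p 0 * ∑' i : ℤ, x ^ (2 * i - 1) * p ^ (i * i - i)

/-- `ℤ × ℤ` as the disjoint union of the pairs with even and with odd sum. -/
noncomputable def paritySplit : (ℤ × ℤ) ⊕ (ℤ × ℤ) ≃ ℤ × ℤ :=
  Equiv.ofBijective
    (Sum.elim (fun x => (x.1 + x.2, x.1 - x.2)) (fun x => (x.1 + x.2, x.1 - x.2 + 1))) <| by
    constructor
    · rintro (⟨a, b⟩ | ⟨a, b⟩) (⟨c, d⟩ | ⟨c, d⟩) h <;>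
        simp only [Sum.elim_inl, Sum.elim_inr, Prod.mk.injEq, Sum.inl.injEq, Sum.inr.injEq,
          reduceCtorEq] at h ⊢ <;> lia
    · rintro ⟨m, n⟩
      rcases Int.even_or_odd' (m + n) with ⟨k, hk | hk⟩
      · exact ⟨.inl (k, m - k), by simp; lia⟩
      · exact ⟨.inr (k, m - k), by simp; lia⟩

lemma paritySplit_inl (x : ℤ × ℤ) : paritySplit (.inl x) = (x.1 + x.2, x.1 - x.2) := rfl

lemma paritySplit_inr (x : ℤ × ℤ) : paritySplit (.inr x) = (x.1 + x.2, x.1 - x.2 + 1) := rfl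

lemma neg_one_zpow_mul_self (k : ℤ) : (-1 : ℂ) ^ k * (-1) ^ k = 1 := by
  rw [← mul_zpow]; simp

/-- The cross terms ij cancel in the sum of the two triangular numbers, so the product separates
into a function of i and one of j. -/
lemma thetaCoeff_mul_even (hp : ‖p‖ < 1) (hp0 : p ≠ 0) (i j : ℤ) :
    thetaCoeff p (i + j) * thetaCoeff p (i - j) =
      thetaCoeff p 0 ^ 2 * (p ^ (i * i - i) * p ^ (j * j)) := by
  rw [thetaCoeff_eq hp hp0 (i + j), thetaCoeff_eq hp hp0 (i - j), ← zpow_add₀ hp0]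
  have h : triangular (i + j) + triangular (i - j) = i * i - i + j * j := by
    linarith [two_mul_triangular (i + j), two_mul_triangular (i - j)]
  rw [← h, zpow_add₀ hp0, zpow_add₀ (by norm_num), zpow_sub₀ (by norm_num)]
  have h1 := neg_one_zpow_mul_self i
  have h2 : (-1 : ℂ) ^ j / (-1) ^ j = 1 := div_self (zpow_ne_zero _ (by norm_num))
  linear_combination (thetaCoeff p 0 ^ 2 * p ^ triangular (i + j) * p ^ triangular (i - j)) *
    (((-1 : ℂ) ^ j / (-1) ^ j) * h1 + h2)

lemma thetaCoeff_mul_odd (hp : ‖p‖ < 1) (hp0 : p ≠ 0) (i j : ℤ) :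
    thetaCoeff p (i + j) * thetaCoeff p (i - j + 1) =
      -(thetaCoeff p 0 ^ 2 * (p ^ (i * i) * p ^ (j * j - j))) := by
  rw [thetaCoeff_add_one hp hp0 (i - j), mul_neg, mul_left_comm, thetaCoeff_mul_even hp hp0]
  have : p ^ (i - j) * (p ^ (i * i - i) * p ^ (j * j)) = p ^ (i * i) * p ^ (j * j - j) := by
    simp only [← zpow_add₀ hp0]; congr 1; ring
  linear_combination (-(thetaCoeff p 0 ^ 2)) * this

/-- The antisymmetric function `θ(x y) θ(x / y) / x`. -/
noncomputable def thetaPair (p x y : ℂ) : ℂ := thetaProd p (x * y) * thetaProd p (x / y) / x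

lemma tsum_mul_tsum_of_summable_prod {f g : ℤ → ℂ}
    (h : Summable fun x : ℤ × ℤ => f x.1 * g x.2) :
    ∑' x : ℤ × ℤ, f x.1 * g x.2 = (∑' i, f i) * ∑' j, g j := by
  rw [h.tsum_prod]
  simp only [tsum_mul_left, tsum_mul_right]

lemma thetaPair_eq (hp : ‖p‖ < 1) (hp0 : p ≠ 0) {x y : ℂ} (hx : x ≠ 0) (hy : y ≠ 0) :
    thetaPair p x y = thetaOdd p x * thetaEven p y - thetaEven p x * thetaOdd p y := by
  have h1 := hasSum_thetaCoeff hp (mul_ne_zero hx hy)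
  have h2 := hasSum_thetaCoeff hp (div_ne_zero hx hy)
  have hs : Summable fun a : ℤ × ℤ =>
      (thetaCoeff p a.1 * (x * y) ^ a.1) * (thetaCoeff p a.2 * (x / y) ^ a.2) :=
    summable_mul_of_summable_norm (f := fun k : ℤ => thetaCoeff p k * (x * y) ^ k)
      (g := fun k : ℤ => thetaCoeff p k * (x / y) ^ k) h1.summable.norm h2.summable.norm
  have H : HasSum (fun b => (thetaCoeff p (paritySplit b).1 * (x * y) ^ (paritySplit b).1) *
      (thetaCoeff p (paritySplit b).2 * (x / y) ^ (paritySplit b).2) * x⁻¹)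
      (thetaProd p (x * y) * thetaProd p (x / y) * x⁻¹) :=
    (paritySplit.hasSum_iff.2 (HasSum.mul (f := fun k : ℤ => thetaCoeff p k * (x * y) ^ k)
      (g := fun k : ℤ => thetaCoeff p k * (x / y) ^ k) h1 h2 hs)).mul_right x⁻¹
  have hS := H.summable
  have e1 : ∀ a : ℤ × ℤ, (thetaCoeff p (a.1 + a.2) * (x * y) ^ (a.1 + a.2)) *
      (thetaCoeff p (a.1 - a.2) * (x / y) ^ (a.1 - a.2)) * x⁻¹ =
      (thetaCoeff p 0 * (x ^ (2 * a.1 - 1) * p ^ (a.1 * a.1 - a.1))) *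
      (thetaCoeff p 0 * (y ^ (2 * a.2) * p ^ (a.2 * a.2))) := by
    rintro ⟨i, j⟩
    have hx' : x ^ (2 * i - 1) = x ^ (i + j) * x ^ (i - j) * x⁻¹ := by
      rw [← zpow_add₀ hx, zpow_sub_one₀ hx]; congr 2; ring
    have hy' : y ^ (2 * j) = y ^ (i + j) * (y ^ (i - j))⁻¹ := by
      rw [← zpow_neg, ← zpow_add₀ hy]; congr 1; ring
    simp only [hx', hy', mul_zpow, div_eq_mul_inv, inv_zpow]
    linear_combination (x ^ (i + j) * x ^ (i - j) * x⁻¹ * y ^ (i + j) * (y ^ (i - j))⁻¹) *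
      thetaCoeff_mul_even hp hp0 i j
  have e2 : ∀ a : ℤ × ℤ, (thetaCoeff p (a.1 + a.2) * (x * y) ^ (a.1 + a.2)) *
      (thetaCoeff p (a.1 - a.2 + 1) * (x / y) ^ (a.1 - a.2 + 1)) * x⁻¹ =
      (thetaCoeff p 0 * (x ^ (2 * a.1) * p ^ (a.1 * a.1))) *
      (-(thetaCoeff p 0 * (y ^ (2 * a.2 - 1) * p ^ (a.2 * a.2 - a.2)))) := by
    rintro ⟨i, j⟩
    have hx' : x ^ (2 * i) = x ^ (i + j) * x ^ (i - j + 1) * x⁻¹ := by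
      rw [← zpow_add₀ hx, ← zpow_sub_one₀ hx]; congr 1; ring
    have hy' : y ^ (2 * j - 1) = y ^ (i + j) * (y ^ (i - j + 1))⁻¹ := by
      rw [← zpow_neg, ← zpow_add₀ hy]; congr 1; ring
    simp only [hx', hy', mul_zpow, div_eq_mul_inv, inv_zpow]
    linear_combination (x ^ (i + j) * x ^ (i - j + 1) * x⁻¹ * y ^ (i + j) *
      (y ^ (i - j + 1))⁻¹) * thetaCoeff_mul_odd hp hp0 i j
  have s1 := hS.comp_injective Sum.inl_injective
  have s2 := hS.comp_injective Sum.inr_injective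
  have T := H.tsum_eq
  rw [Summable.tsum_sum s1 s2] at T
  simp only [Function.comp_def, paritySplit_inl, paritySplit_inr, e1, e2] at T s1 s2
  rw [tsum_mul_tsum_of_summable_prod
      (f := fun i : ℤ => thetaCoeff p 0 * (x ^ (2 * i - 1) * p ^ (i * i - i)))
      (g := fun j : ℤ => thetaCoeff p 0 * (y ^ (2 * j) * p ^ (j * j))) s1,
    tsum_mul_tsum_of_summable_prod
      (f := fun i : ℤ => thetaCoeff p 0 * (x ^ (2 * i) * p ^ (i * i)))
      (g := fun j : ℤ => -(thetaCoeff p 0 * (y ^ (2 * j - 1) * p ^ (j * j - j)))) s2] at T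
  simp only [tsum_mul_left, tsum_neg] at T
  rw [thetaPair, div_eq_mul_inv, ← T, thetaOdd, thetaEven, thetaEven, thetaOdd]
  ring

/-- Weierstrass's three-term relation. -/
lemma thetaPair_three_term (hp : ‖p‖ < 1) (hp0 : p ≠ 0) {x y z w : ℂ} (hx : x ≠ 0) (hy : y ≠ 0)
    (hz : z ≠ 0) (hw : w ≠ 0) :
    thetaPair p x y * thetaPair p z w - thetaPair p x z * thetaPair p y w +
      thetaPair p x w * thetaPair p y z = 0 := by
  -- Every pair is now a 2×2 minor of a 2×4 matrix, and the claim is the Plücker relation.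
  simp only [thetaPair_eq hp hp0 hx hy, thetaPair_eq hp hp0 hz hw, thetaPair_eq hp hp0 hx hz,
    thetaPair_eq hp hp0 hy hw, thetaPair_eq hp hp0 hx hw, thetaPair_eq hp hp0 hy hz]
  ring

end threeTerm

/-! ### Logarithmic derivative of theta and the triplication formula. -/

section thetaLog

variable {p : ℂ}

/-- The Euler operator `z d/dz` applied to `log θ(z)`. -/
noncomputable def thetaLog (p z : ℂ) : ℂ := z * logDeriv (thetaProd p) z

lemma thetaProd_eq_one_sub_mul (hp : ‖p‖ < 1) (z : ℂ) :
    thetaProd p z = (1 - z) * (qPochInf p (z * p) * qPochInf p (p / z)) := by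
  rw [thetaProd, qPochInf_eq_one_sub_mul hp z, mul_assoc]

lemma thetaProd_one (hp : ‖p‖ < 1) : thetaProd p 1 = 0 := by
  simp [thetaProd_eq_one_sub_mul hp]

lemma thetaProd_mul (hp : ‖p‖ < 1) (hp0 : p ≠ 0) {z : ℂ} (hz : z ≠ 0) :
    thetaProd p (p * z) = -thetaProd p z / z := by
  rw [thetaProd_eq_one_sub_mul hp z, thetaProd, show p / (p * z) = z⁻¹ by field_simp,
    qPochInf_eq_one_sub_mul hp z⁻¹, mul_comm p z, inv_mul_eq_div]
  field_simp
  ring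

lemma thetaProd_inv (hp : ‖p‖ < 1) {z : ℂ} (hz : z ≠ 0) :
    thetaProd p z⁻¹ = -thetaProd p z / z := by
  rw [thetaProd_eq_one_sub_mul hp z, thetaProd, div_inv_eq_mul,
    qPochInf_eq_one_sub_mul hp z⁻¹, mul_comm p z, inv_mul_eq_div]
  field_simp
  ring

lemma differentiableAt_thetaProd (hp : ‖p‖ < 1) {z : ℂ} (hz : z ≠ 0) :
    DifferentiableAt ℂ (thetaProd p) z := by
  have h1 := differentiable_qPochInf hp
  have h2 : DifferentiableAt ℂ (fun z => p / z) z := by fun_prop (disch := assumption)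
  exact (h1 z).mul ((h1 (p / z)).comp z h2)

lemma hasDerivAt_thetaProd (hp : ‖p‖ < 1) {z : ℂ} (hz : z ≠ 0) (hθ : thetaProd p z ≠ 0) :
    HasDerivAt (thetaProd p) (thetaProd p z * thetaLog p z / z) z := by
  convert! (differentiableAt_thetaProd hp hz).hasDerivAt using 1
  rw [thetaLog, logDeriv_apply]
  field_simp

/-- Since θ(1) = 0, the logarithmic derivative is useless here; the factor 1 - z is split off
instead. -/
lemma hasDerivAt_thetaProd_one (hp : ‖p‖ < 1) :
    HasDerivAt (thetaProd p) (-qPochInf p p ^ 2) 1 := by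
  have h1 := differentiable_qPochInf hp
  have h2 : DifferentiableAt ℂ (fun z => p / z) 1 := by fun_prop (disch := simp)
  have h3 : DifferentiableAt ℂ (fun z => z * p) 1 := by fun_prop
  have hR : DifferentiableAt ℂ (fun z => qPochInf p (z * p) * qPochInf p (p / z)) 1 :=
    ((h1 _).comp 1 h3).mul ((h1 _).comp 1 h2)
  have h4 := ((hasDerivAt_id (1 : ℂ)).const_sub 1).mul hR.hasDerivAt
  have e : thetaProd p =
      (fun z => 1 - id z) * fun z => qPochInf p (z * p) * qPochInf p (p / z) :=
    funext fun z => thetaProd_eq_one_sub_mul hp z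
  rw [e]
  convert! h4 using 1
  simp
  ring

lemma thetaLog_mul (hp : ‖p‖ < 1) (hp0 : p ≠ 0) {z : ℂ} (hz : z ≠ 0) (hθ : thetaProd p z ≠ 0) :
    thetaLog p (p * z) = thetaLog p z - 1 := by
  have hpz := mul_ne_zero hp0 hz
  have e := thetaProd_mul hp hp0 hz
  have hθ' : thetaProd p (p * z) ≠ 0 := by
    rw [e]; exact div_ne_zero (neg_ne_zero.2 hθ) hz
  have h1 : HasDerivAt (fun z => thetaProd p (p * z)) _ z :=
    (hasDerivAt_thetaProd hp hpz hθ').comp z ((hasDerivAt_id z).const_mul p)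
  have h2 : HasDerivAt (fun z => -thetaProd p z / z) _ z :=
    (hasDerivAt_thetaProd hp hz hθ).neg.div (hasDerivAt_id z) hz
  have h3 := h1.unique (h2.congr_of_eventuallyEq
    ((eventually_ne_nhds hz).mono fun w hw => thetaProd_mul hp hp0 hw))
  simp only [Pi.neg_apply, mul_one, e] at h3
  generalize thetaLog p (p * z) = l at h3 ⊢
  field_simp at h3
  linear_combination -h3

lemma thetaLog_inv (hp : ‖p‖ < 1) {z : ℂ} (hz : z ≠ 0) (hθ : thetaProd p z ≠ 0) :
    thetaLog p z⁻¹ = 1 - thetaLog p z := by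
  have hpz := inv_ne_zero hz
  have e := thetaProd_inv hp hz
  have hθ' : thetaProd p z⁻¹ ≠ 0 := by
    rw [e]; exact div_ne_zero (neg_ne_zero.2 hθ) hz
  have h1 : HasDerivAt (fun z => thetaProd p z⁻¹) _ z :=
    (hasDerivAt_thetaProd hp hpz hθ').comp z (hasDerivAt_inv hz)
  have h2 : HasDerivAt (fun z => -thetaProd p z / z) _ z :=
    (hasDerivAt_thetaProd hp hz hθ).neg.div (hasDerivAt_id z) hz
  have h3 := h1.unique (h2.congr_of_eventuallyEq
    ((eventually_ne_nhds hz).mono fun w hw => thetaProd_inv hp hw))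
  simp only [Pi.neg_apply, mul_one, e] at h3
  generalize thetaLog p z⁻¹ = l at h3 ⊢
  field_simp at h3
  linear_combination h3

lemma hasDerivAt_thetaPair (hp : ‖p‖ < 1) {x y : ℂ} (hx : x ≠ 0) (hy : y ≠ 0)
    (h1 : thetaProd p (x * y) ≠ 0) (h2 : thetaProd p (x / y) ≠ 0) :
    HasDerivAt (thetaPair p x)
      (thetaPair p x y * (thetaLog p (x * y) - thetaLog p (x / y)) / y) y := by
  have d1 : HasDerivAt (fun y => thetaProd p (x * y)) _ y :=
    (hasDerivAt_thetaProd hp (mul_ne_zero hx hy) h1).comp y ((hasDerivAt_id y).const_mul x)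
  have d2 : HasDerivAt (fun y => thetaProd p (x / y)) _ y :=
    (hasDerivAt_thetaProd hp (div_ne_zero hx hy) h2).comp y
      ((hasDerivAt_const y x).div (hasDerivAt_id y) hy)
  convert! (d1.mul d2).div_const x using 1
  simp only [thetaPair]
  field_simp
  ring

/-- On the diagonal θ(x/y) vanishes, so only its own derivative survives; this is the source of
(p;p)_∞². -/
lemma hasDerivAt_thetaPair_self (hp : ‖p‖ < 1) {x : ℂ} (hx : x ≠ 0) :
    HasDerivAt (thetaPair p x) (thetaProd p (x ^ 2) * qPochInf p p ^ 2 / x ^ 2) x := by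
  have d1 : HasDerivAt (fun y => thetaProd p (x * y)) _ x :=
    ((differentiableAt_thetaProd hp (mul_ne_zero hx hx)).hasDerivAt).comp x
      ((hasDerivAt_id x).const_mul x)
  have d0 : HasDerivAt (thetaProd p) (-qPochInf p p ^ 2) (x / x) := by
    rw [div_self hx]; exact hasDerivAt_thetaProd_one hp
  have d2 : HasDerivAt (fun y => thetaProd p (x / y)) _ x :=
    d0.comp x ((hasDerivAt_const x x).div (hasDerivAt_id x) hx)
  convert! (d1.mul d2).div_const x using 1
  simp only [div_self hx, thetaProd_one hp, ← pow_two]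
  field_simp
  ring

/-- The triplication formula for the logarithmic derivative of the theta function. -/
theorem thetaProd_triplication (hp : ‖p‖ < 1) (hp0 : p ≠ 0) {a : ℂ} (ha : a ≠ 0)
    (h1 : thetaProd p a ≠ 0) (h3 : thetaProd p (a ^ 3) ≠ 0) :
    thetaProd p (a ^ 2) ^ 3 * qPochInf p p ^ 2 =
      thetaProd p (a ^ 3) * thetaProd p a ^ 3 * (1 - 3 * thetaLog p a + thetaLog p (a ^ 3)) := by
  have e1 : a ^ 2 * a = a ^ 3 := by ring
  have e2 : a ^ 2 / a = a := by field_simp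
  have hi := thetaProd_inv hp ha
  have h1' : thetaProd p a⁻¹ ≠ 0 := by
    rw [hi]; exact div_ne_zero (neg_ne_zero.2 h1) ha
  -- The three-term relation at (a², 1, a, w), differentiated in w at w = a, where its first term
  -- vanishes.
  have d1 := (hasDerivAt_thetaPair_self hp ha).const_mul (thetaPair p (a ^ 2) 1)
  have d2 := (hasDerivAt_thetaPair hp one_ne_zero ha (by simpa using h1)
    (by simpa using h1')).const_mul (thetaPair p (a ^ 2) a)
  have d3 := (hasDerivAt_thetaPair hp (pow_ne_zero 2 ha) ha (by rwa [e1])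
    (by rwa [e2])).mul_const (thetaPair p 1 a)
  have D := ((d1.sub d2).add d3).unique ((hasDerivAt_const a (0 : ℂ)).congr_of_eventuallyEq
    ((eventually_ne_nhds ha).mono fun w hw =>
      thetaPair_three_term hp hp0 (pow_ne_zero 2 ha) one_ne_zero ha hw))
  simp only [thetaPair, e1, e2, mul_one, div_one, one_mul, one_div, hi, thetaLog_inv hp ha h1] at D
  field_simp at D
  linear_combination D

end thetaLog

/-! ### Lambert series for divisor counts. -/

section lambert

variable {q : ℂ}

lemma tsum_pow_mul_pnat (hq : ‖q‖ < 1) (d : ℕ+) :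
    ∑' m : ℕ+, q ^ (d * m : ℕ) = q ^ (d : ℕ) / (1 - q ^ (d : ℕ)) := by
  have hd : ‖q ^ (d : ℕ)‖ < 1 := by
    rw [norm_pow]; exact pow_lt_one₀ (norm_nonneg _) hq d.ne_zero
  rw [tsum_pnat_eq_tsum_succ (f := fun m => q ^ ((d : ℕ) * m))]
  simp only [mul_add, mul_one, pow_add, pow_mul]
  rw [tsum_mul_right, tsum_geometric_of_norm_lt_one hd, inv_mul_eq_div]

/-- The Lambert series that counts the divisors in a residue class. -/
lemma hasSum_divisorCount (hq : ‖q‖ < 1) {j k : ℕ} (hj : 0 < j) (hjk : j < k) :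
    HasSum (fun n : ℕ => (divisorCount j k (n + 1) : ℂ) * q ^ (n + 1))
      (∑' n : ℕ, q ^ (k * n + j) / (1 - q ^ (k * n + j))) := by
  -- One double sum over (d, m): summing over m first gives the Lambert series, grouping by n = dm
  -- gives the divisor counts.
  let F : ℕ+ × ℕ+ → ℂ := fun x => if (x.1 : ℕ) ≡ j [MOD k] then q ^ (x.1 * x.2 : ℕ) else 0
  have hF : Summable F := by
    refine Summable.of_norm_bounded (summable_prod_mul_pow 0 hq).norm fun x => ?_
    simp only [F]
    split_ifs <;> simp
  have h1 : ∑' x, F x = ∑' n : ℕ, q ^ (k * n + j) / (1 - q ^ (k * n + j)) := by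
    let i : ℕ → ℕ+ := fun n => ⟨k * n + j, by positivity⟩
    have hi : Function.Injective i := fun a b h => by
      have : k * a + j = k * b + j := congrArg PNat.val h
      exact Nat.eq_of_mul_eq_mul_left (by lia) (Nat.add_right_cancel this)
    have e (d : ℕ+) : ∑' m : ℕ+, F (d, m) =
        if (d : ℕ) ≡ j [MOD k] then q ^ (d : ℕ) / (1 - q ^ (d : ℕ)) else 0 := by
      simp only [F]
      split_ifs
      · exact tsum_pow_mul_pnat hq d
      · exact tsum_zero
    rw [hF.tsum_prod, tsum_congr e, ← hi.tsum_eq]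
    · refine tsum_congr fun n => if_pos ?_
      simp [i, Nat.ModEq]
    · intro d hd
      have hdj : (d : ℕ) ≡ j [MOD k] := by
        by_contra h
        simp [h] at hd
      refine ⟨(d : ℕ) / k, PNat.eq ?_⟩
      have := Nat.div_add_mod (d : ℕ) k
      rw [hdj, Nat.mod_eq_of_lt hjk] at this
      exact this
  have h2 : HasSum (fun n : ℕ+ => (divisorCount j k n : ℂ) * q ^ (n : ℕ)) (∑' x, F x) := by
    refine (sigmaAntidiagonalEquivProd.hasSum_iff.2 hF.hasSum).sigma fun n => ?_
    convert! hasSum_fintype _ using 1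
    have e (c : { x // x ∈ (n : ℕ).divisorsAntidiagonal }) :
        (F ∘ sigmaAntidiagonalEquivProd) ⟨n, c⟩ =
          if (c : ℕ × ℕ).1 ≡ j [MOD k] then q ^ (n : ℕ) else 0 := by
      have := (Nat.mem_divisorsAntidiagonal.1 c.2).1
      simp [F, sigmaAntidiagonalEquivProd, divisorsAntidiagonalFactors, this]
    rw [Finset.sum_congr rfl fun c _ => e c, Finset.univ_eq_attach,
      (n : ℕ).divisorsAntidiagonal.sum_attach
        fun x : ℕ × ℕ => if x.1 ≡ j [MOD k] then q ^ (n : ℕ) else 0,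
      Nat.sum_divisorsAntidiagonal fun x _ => if x ≡ j [MOD k] then q ^ (n : ℕ) else 0,
      ← Finset.sum_filter, Finset.sum_const, nsmul_eq_mul, divisorCount]
  rw [← h1]
  exact Equiv.pnatEquivNat.symm.hasSum_iff.2 h2

end lambert

/-! ### Specialisation to base q⁵. -/

section quintic

variable {q : ℂ}

lemma norm_pow_lt_one_of_pos (hq : ‖q‖ < 1) {n : ℕ} (hn : 0 < n) : ‖q ^ n‖ < 1 := by
  rw [norm_pow]; exact pow_lt_one₀ (norm_nonneg _) hq hn.ne'

lemma pow_ne_one_of_norm_lt_one (hq : ‖q‖ < 1) {n : ℕ} (hn : 0 < n) : q ^ n ≠ 1 := by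
  intro h
  have := norm_pow_lt_one_of_pos hq hn
  simp [h] at this

lemma pow_mul_pow_pow_ne_one (hq : ‖q‖ < 1) {j : ℕ} (hj : 0 < j) (k n : ℕ) :
    q ^ j * (q ^ k) ^ n ≠ 1 := by
  rw [← pow_mul, ← pow_add]
  exact pow_ne_one_of_norm_lt_one hq (by lia)

lemma qPochInf_pow_ne_zero (hq : ‖q‖ < 1) {j k : ℕ} (hj : 0 < j) (hk : 0 < k) :
    qPochInf (q ^ k) (q ^ j) ≠ 0 :=
  qPochInf_ne_zero (norm_pow_lt_one_of_pos hq hk) (pow_mul_pow_pow_ne_one hq hj k)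

lemma hasProd_qPochInf_pow (hq : ‖q‖ < 1) (j : ℕ) {k : ℕ} (hk : 0 < k) :
    HasProd (fun n : ℕ => 1 - q ^ (k * n + j)) (qPochInf (q ^ k) (q ^ j)) := by
  convert! hasProd_qPochInf (norm_pow_lt_one_of_pos hq hk) (q ^ j) using 2 with n
  ring

lemma prod_range_five_mul (f : ℕ → ℂ) (N : ℕ) :
    ∏ i ∈ Finset.range (5 * N), f i = ∏ n ∈ Finset.range N,
      (f (5 * n) * f (5 * n + 1) * f (5 * n + 2) * f (5 * n + 3) * f (5 * n + 4)) := by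
  induction N with
  | zero => simp
  | succ N ih =>
    rw [Finset.prod_range_succ, ← ih, show 5 * (N + 1) = 5 * N + 1 + 1 + 1 + 1 + 1 by ring]
    simp only [Finset.prod_range_succ]
    ring

/-- Partial products of length 5N regroup by residue class mod 5. -/
lemma qPochInf_self_eq_mul_five (hq : ‖q‖ < 1) :
    qPochInf q q = qPochInf (q ^ 5) (q ^ 1) * qPochInf (q ^ 5) (q ^ 2) * qPochInf (q ^ 5) (q ^ 3) *
      qPochInf (q ^ 5) (q ^ 4) * qPochInf (q ^ 5) (q ^ 5) := by
  have h (j : ℕ) := hasProd_qPochInf_pow hq j (show 0 < 5 by norm_num)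
  have h1 := (((((h 1).mul (h 2)).mul (h 3)).mul (h 4)).mul (h 5)).tendsto_prod_nat
  have h2 := (hasProd_qPochInf hq q).tendsto_prod_nat.comp
    (tendsto_id.const_mul_atTop' (show 0 < 5 by norm_num))
  refine tendsto_nhds_unique h2 (h1.congr fun N => ?_)
  simp only [Function.comp_apply, id_eq, prod_range_five_mul, ← pow_succ', add_assoc]

lemma thetaProd_pow_five (hq0 : q ≠ 0) {j : ℕ} (hj : j ≤ 5) :
    thetaProd (q ^ 5) (q ^ j) = qPochInf (q ^ 5) (q ^ j) * qPochInf (q ^ 5) (q ^ (5 - j)) := by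
  rw [thetaProd, pow_sub₀ q hq0 hj, div_eq_mul_inv]

lemma thetaLog_pow_five (hq : ‖q‖ < 1) (hq0 : q ≠ 0) {j : ℕ} (hj : 0 < j) (hj5 : j < 5) :
    thetaLog (q ^ 5) (q ^ j) =
      (∑' n : ℕ, q ^ (5 * n + (5 - j)) / (1 - q ^ (5 * n + (5 - j)))) -
        ∑' n : ℕ, q ^ (5 * n + j) / (1 - q ^ (5 * n + j)) := by
  have hp := norm_pow_lt_one_of_pos hq (show 0 < 5 by norm_num)
  have hz := pow_ne_zero j hq0
  have e : q ^ 5 / q ^ j = q ^ (5 - j) := by rw [pow_sub₀ q hq0 hj5.le, div_eq_mul_inv]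
  have hd := differentiable_qPochInf hp
  have h1 : HasDerivAt (qPochInf (q ^ 5)) _ (q ^ j) := (hd _).hasDerivAt
  have h2 : HasDerivAt (fun z => qPochInf (q ^ 5) (q ^ 5 / z)) _ (q ^ j) :=
    (hd _).hasDerivAt.comp (q ^ j)
      ((hasDerivAt_const (q ^ j) (q ^ 5)).div (hasDerivAt_id (q ^ j)) hz)
  have hn1 := qPochInf_pow_ne_zero hq hj (show 0 < 5 by norm_num)
  have hn2 := qPochInf_pow_ne_zero hq (show 0 < 5 - j by lia) (show 0 < 5 by norm_num)
  have l1 := logDeriv_qPochInf hp (pow_mul_pow_pow_ne_one hq hj 5)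
  have l2 := logDeriv_qPochInf hp (pow_mul_pow_pow_ne_one hq (show 0 < 5 - j by lia) 5)
  have s (j : ℕ) : ∑' n : ℕ, q ^ (5 * n + j) / (1 - q ^ (5 * n + j)) =
      q ^ j * ∑' n : ℕ, (q ^ 5) ^ n / (1 - q ^ j * (q ^ 5) ^ n) := by
    rw [← tsum_mul_left]
    refine tsum_congr fun n => ?_
    rw [pow_add, pow_mul, mul_comm ((q ^ 5) ^ n), mul_div_assoc]
  rw [logDeriv_apply] at l1 l2
  have h3 : HasDerivAt (thetaProd (q ^ 5)) _ (q ^ j) := h1.mul h2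
  rw [s, s, thetaLog, logDeriv_apply, h3.deriv, thetaProd, e, ← neg_inj.2 l1 |>.trans (neg_neg _),
    ← neg_inj.2 l2 |>.trans (neg_neg _), ← e]
  rw [← e] at hn2
  field_simp
  simp
  ring

end quintic

/-! ### The two quintic products. -/

section products

variable {q : ℂ}

lemma hasProd_quintic (hq : ‖q‖ < 1) {i j : ℕ} (hi : 0 < i) (hj : 0 < j) :
    HasProd (fun n : ℕ => (1 - q ^ (n + 1)) ^ 2 /
        ((1 - q ^ (5 * n + i)) ^ 5 * (1 - q ^ (5 * n + j)) ^ 5))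
      (qPochInf q q ^ 2 / (qPochInf (q ^ 5) (q ^ i) ^ 5 * qPochInf (q ^ 5) (q ^ j) ^ 5)) := by
  have h5 : 0 < 5 := by norm_num
  have h : HasProd (fun n : ℕ => 1 - q ^ (n + 1)) (qPochInf q q) := by
    simpa only [pow_succ'] using hasProd_qPochInf hq q
  exact (h.pow 2).div₀ (((hasProd_qPochInf_pow hq i h5).pow 5).mul
    ((hasProd_qPochInf_pow hq j h5).pow 5))
    (mul_ne_zero (pow_ne_zero _ (qPochInf_pow_ne_zero hq hi h5))
      (pow_ne_zero _ (qPochInf_pow_ne_zero hq hj h5)))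

lemma hasSum_divisorCount_sub (hq : ‖q‖ < 1) (hq0 : q ≠ 0) {j : ℕ} (hj : 0 < j) (hj5 : j < 5) :
    HasSum (fun n : ℕ =>
      ((divisorCount j 5 (n + 1) : ℂ) - (divisorCount (5 - j) 5 (n + 1) : ℂ)) * q ^ (n + 1))
      (-thetaLog (q ^ 5) (q ^ j)) := by
  rw [thetaLog_pow_five hq hq0 hj hj5, neg_sub]
  simpa only [sub_mul] using (hasSum_divisorCount hq hj hj5).sub
    (hasSum_divisorCount hq (show 0 < 5 - j by lia) (show 5 - j < 5 by lia))

lemma thetaProd_pow_five_ne_zero (hq : ‖q‖ < 1) (hq0 : q ≠ 0) {j : ℕ} (hj : 0 < j) (hj5 : j < 5) :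
    thetaProd (q ^ 5) (q ^ j) ≠ 0 := by
  rw [thetaProd_pow_five hq0 hj5.le]
  exact mul_ne_zero (qPochInf_pow_ne_zero hq hj (by norm_num))
    (qPochInf_pow_ne_zero hq (by lia) (by norm_num))

lemma thetaLog_pow_three_eq_neg (hq : ‖q‖ < 1) (hq0 : q ≠ 0) :
    thetaLog (q ^ 5) (q ^ 3) = -thetaLog (q ^ 5) (q ^ 2) := by
  rw [thetaLog_pow_five hq hq0 (by norm_num) (by norm_num),
    thetaLog_pow_five hq hq0 (by norm_num) (by norm_num)]
  norm_num

/-- `(q)_∞² / ((q, q⁴; q⁵)_∞)⁵` in terms of logarithmic derivatives of theta. -/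
lemma quintic_product_one_four (hq : ‖q‖ < 1) (hq0 : q ≠ 0) :
    qPochInf q q ^ 2 / (qPochInf (q ^ 5) (q ^ 4) ^ 5 * qPochInf (q ^ 5) (q ^ 1) ^ 5) =
      1 - 3 * thetaLog (q ^ 5) (q ^ 1) - thetaLog (q ^ 5) (q ^ 2) := by
  have h (j : ℕ) (hj : 0 < j) := qPochInf_pow_ne_zero hq hj (show 0 < 5 by norm_num)
  have h1 := h 1 (by norm_num)
  have h2 := h 2 (by norm_num)
  have h3 := h 3 (by norm_num)
  have h4 := h 4 (by norm_num)
  have T := thetaProd_triplication (norm_pow_lt_one_of_pos hq (show 0 < 5 by norm_num))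
    (pow_ne_zero 5 hq0) (pow_ne_zero 1 hq0)
    (thetaProd_pow_five_ne_zero hq hq0 (by norm_num) (by norm_num))
    (by
      rw [← pow_mul]
      exact thetaProd_pow_five_ne_zero hq hq0 (by norm_num) (by norm_num))
  rw [← pow_mul, ← pow_mul, one_mul, one_mul, thetaLog_pow_three_eq_neg hq hq0,
    thetaProd_pow_five hq0 (by norm_num), thetaProd_pow_five hq0 (by norm_num),
    thetaProd_pow_five hq0 (by norm_num)] at T
  norm_num only at T
  -- Here a = q. As θ(q³) = θ(q²), one factor θ(q²) cancels from the triplication formula.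
  rw [qPochInf_self_eq_mul_five hq, div_eq_iff (by positivity)]
  refine mul_left_cancel₀ (mul_ne_zero h2 h3) ?_
  linear_combination (qPochInf (q ^ 5) (q ^ 1) ^ 2 * qPochInf (q ^ 5) (q ^ 4) ^ 2) * T

/-- `q (q)_∞² / ((q², q³; q⁵)_∞)⁵` in terms of logarithmic derivatives of theta. -/
lemma quintic_product_two_three (hq : ‖q‖ < 1) (hq0 : q ≠ 0) :
    q * (qPochInf q q ^ 2 / (qPochInf (q ^ 5) (q ^ 3) ^ 5 * qPochInf (q ^ 5) (q ^ 2) ^ 5)) =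
      -thetaLog (q ^ 5) (q ^ 1) + 3 * thetaLog (q ^ 5) (q ^ 2) := by
  have hp := norm_pow_lt_one_of_pos hq (show 0 < 5 by norm_num)
  have hp0 := pow_ne_zero 5 hq0
  have h (j : ℕ) (hj : 0 < j) := qPochInf_pow_ne_zero hq hj (show 0 < 5 by norm_num)
  have h1 := h 1 (by norm_num)
  have h2 := h 2 (by norm_num)
  have h3 := h 3 (by norm_num)
  have h4 := h 4 (by norm_num)
  have hθ := thetaProd_pow_five_ne_zero hq hq0 (show 0 < 1 by norm_num) (by norm_num)
  have e6 : (q ^ 2) ^ 3 = q ^ 5 * q ^ 1 := by ring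
  have t6 := thetaProd_mul hp hp0 (pow_ne_zero 1 hq0)
  have T := thetaProd_triplication hp hp0 (pow_ne_zero 2 hq0)
    (thetaProd_pow_five_ne_zero hq hq0 (by norm_num) (by norm_num))
    (by
      rw [e6, t6]
      exact div_ne_zero (neg_ne_zero.2 hθ) (pow_ne_zero 1 hq0))
  -- Here a = q². The shift L(q⁶) = L(q) - 1 cancels the constant 1, and θ(q⁶) = -θ(q)/q supplies
  -- the prefactor q.
  rw [e6, t6, thetaLog_mul hp hp0 (pow_ne_zero 1 hq0) hθ, ← pow_mul,
    thetaProd_pow_five hq0 (by norm_num), thetaProd_pow_five hq0 (by norm_num),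
    thetaProd_pow_five hq0 (by norm_num)] at T
  norm_num only at T
  rw [qPochInf_self_eq_mul_five hq, ← mul_div_assoc, div_eq_iff (by positivity)]
  refine mul_left_cancel₀ (mul_ne_zero h1 h4) ?_
  rw [pow_one, neg_div, neg_mul, neg_mul, div_mul_eq_mul_div, div_mul_eq_mul_div, ← neg_div,
    eq_div_iff hq0] at T
  rw [pow_one]
  linear_combination (qPochInf (q ^ 5) (q ^ 2) ^ 2 * qPochInf (q ^ 5) (q ^ 3) ^ 2) * T

end products

/-- The sums and products over `n ≥ 1` are written over `n : ℕ` with `n + 1` in place of `n`; the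
natural-number subtractions `5 * (n + 1) - i`, `i ≤ 4`, never truncate. The convergence of the
products and of the series is part of the claim. -/
theorem mainTheorem3 (q : ℂ) (hq : ‖q‖ < 1) :
    (Summable fun n : ℕ =>
      ((divisorCount 1 5 (n + 1) : ℂ) - (divisorCount 4 5 (n + 1) : ℂ)) * q ^ (n + 1)) ∧
    (Summable fun n : ℕ =>
      ((divisorCount 2 5 (n + 1) : ℂ) - (divisorCount 3 5 (n + 1) : ℂ)) * q ^ (n + 1)) ∧
    (Multipliable fun n : ℕ =>
      (1 - q ^ (n + 1)) ^ 2 /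
        ((1 - q ^ (5 * (n + 1) - 2)) ^ 5 * (1 - q ^ (5 * (n + 1) - 3)) ^ 5)) ∧
    (Multipliable fun n : ℕ =>
      (1 - q ^ (n + 1)) ^ 2 /
        ((1 - q ^ (5 * (n + 1) - 1)) ^ 5 * (1 - q ^ (5 * (n + 1) - 4)) ^ 5)) ∧
    q * (∏' n : ℕ, (1 - q ^ (n + 1)) ^ 2 /
        ((1 - q ^ (5 * (n + 1) - 2)) ^ 5 * (1 - q ^ (5 * (n + 1) - 3)) ^ 5)) =
      (∑' n : ℕ,
        ((divisorCount 1 5 (n + 1) : ℂ) - (divisorCount 4 5 (n + 1) : ℂ)) * q ^ (n + 1)) -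
      3 * (∑' n : ℕ,
        ((divisorCount 2 5 (n + 1) : ℂ) - (divisorCount 3 5 (n + 1) : ℂ)) * q ^ (n + 1)) ∧
    (∏' n : ℕ, (1 - q ^ (n + 1)) ^ 2 /
        ((1 - q ^ (5 * (n + 1) - 1)) ^ 5 * (1 - q ^ (5 * (n + 1) - 4)) ^ 5)) =
      1 +
      3 * (∑' n : ℕ,
        ((divisorCount 1 5 (n + 1) : ℂ) - (divisorCount 4 5 (n + 1) : ℂ)) * q ^ (n + 1)) +
      (∑' n : ℕ,
        ((divisorCount 2 5 (n + 1) : ℂ) - (divisorCount 3 5 (n + 1) : ℂ)) * q ^ (n + 1)) := by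
  have i1 (n : ℕ) : 5 * (n + 1) - 1 = 5 * n + 4 := by lia
  have i2 (n : ℕ) : 5 * (n + 1) - 2 = 5 * n + 3 := by lia
  have i3 (n : ℕ) : 5 * (n + 1) - 3 = 5 * n + 2 := by lia
  have i4 (n : ℕ) : 5 * (n + 1) - 4 = 5 * n + 1 := by lia
  simp only [i1, i2, i3, i4]
  have P23 := hasProd_quintic hq (show 0 < 3 by norm_num) (show 0 < 2 by norm_num)
  have P14 := hasProd_quintic hq (show 0 < 4 by norm_num) (show 0 < 1 by norm_num)
  -- At q = 0 the base q⁵ and the points q^j degenerate to 0, so the theta argument does not apply;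
  -- the claims are then immediate.
  rcases eq_or_ne q 0 with rfl | hq0
  · refine ⟨?_, ?_, P23.multipliable, P14.multipliable, ?_, ?_⟩ <;> simp
  · have A := hasSum_divisorCount_sub hq hq0 (show 0 < 1 by norm_num) (by norm_num)
    have B := hasSum_divisorCount_sub hq hq0 (show 0 < 2 by norm_num) (by norm_num)
    refine ⟨A.summable, B.summable, P23.multipliable, P14.multipliable, ?_, ?_⟩
    · rw [P23.tprod_eq, A.tsum_eq, B.tsum_eq, quintic_product_two_three hq hq0]
      ring
    · rw [P14.tprod_eq, A.tsum_eq, B.tsum_eq, quintic_product_one_four hq hq0]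
      ring
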